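/- Let a dyadic partition of the open unit cube $(0,1)^3$ be any collection of open boxes $(a_1,b_1)\times(a_2,b_2)\times(a_3,b_3)$ obtained from $\{(0,1)^3\}$ by finitely many steps, where each step chooses a box of the current collection and a coordinate direction and replaces the chosen box by its two halves, obtained by bisecting the side of the box in that direction at its midpoint. Two such partitions are the same if they are equal as collections of boxes, regardless of the order of the steps. For $n\ge 1$ let $C_{3,2}(n)$ be the number of distinct dyadic partitions obtained by exactly $n-1$ steps. Then for every integer $n\ge 1$ the number of dyadic partitions of the unit cube into exactly $n$ boxes is finite and equal to $C_{3,2}(n)$, and $$ C_{3,2}(n)=\frac1n\sum_{j=0}^{\lfloor (n-1)/7\rfloor}\ \sum_{i=0}^{\lfloor (n-1-7j)/3\rfloor}\binom{2(n-1-i-3j)}{\,n-1,\;n-1-3i-7j,\;i,\;j\,}(-1)^i\,3^{\,n-1-2i-7j}, $$ where $\binom{N}{k_1,k_2,k_3,k_4}=\dfrac{N!}{k_1!\,k_2!\,k_3!\,k_4!}$ for $N=k_1+k_2+k_3+k_4$ is the multinomial coefficient. -/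

import Mathlib

/-- The open rectangle `(a 0, b 0) × ⋯ × (a (d-1), b (d-1))` in `ℝ^d`. -/
def openRect {d : ℕ} (a b : Fin d → ℝ) : Set (Fin d → ℝ) :=
  Set.univ.pi fun i => Set.Ioo (a i) (b i)

/-- The `j`-th of the `p + 1` endpoints that cut the interval `(s, t)` into `p` equal parts. -/
noncomputable def cutPoint (p : ℕ) (s t : ℝ) (j : ℕ) : ℝ :=
  s + (j : ℝ) / (p : ℝ) * (t - s)

/-- The `p`-ary decomposition of the rectangle with corners `a` and `b` orthogonal to the `i`-th
coordinate axis: the `i`-th side is replaced by each of its `p` equal subintervals. -/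
def axisCut {d : ℕ} (p : ℕ) (i : Fin d) (a b : Fin d → ℝ) : Set (Set (Fin d → ℝ)) :=
  {Q | ∃ j : ℕ, 1 ≤ j ∧ j ≤ p ∧
    Q = openRect (Function.update a i (cutPoint p (a i) (b i) (j - 1)))
          (Function.update b i (cutPoint p (a i) (b i) j))}

/-- `IsDecomp d p m S`: the collection `S` of open rectangles is obtained from `{(0,1)^d}` by `m`
successive steps, each of which replaces one rectangle of the collection by the `p` parts of its
`p`-ary decomposition orthogonal to some coordinate axis. -/
inductive IsDecomp (d p : ℕ) : ℕ → Set (Set (Fin d → ℝ)) → Prop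
  | unit : IsDecomp d p 0 {openRect (fun _ => 0) (fun _ => 1)}
  | step {m : ℕ} {S : Set (Set (Fin d → ℝ))} (a b : Fin d → ℝ) (i : Fin d)
      (hS : IsDecomp d p m S) (hab : ∀ k, a k < b k) (hR : openRect a b ∈ S) :
      IsDecomp d p (m + 1) ((S \ {openRect a b}) ∪ axisCut p i a b)

/-- The set of all `(d, p, n)`-decompositions: those obtained by `m` steps,
where `n = 1 + m (p - 1)`. -/
def decompositions (d p n : ℕ) : Set (Set (Set (Fin d → ℝ))) :=
  {S | ∃ m : ℕ, n = 1 + m * (p - 1) ∧ IsDecomp d p m S}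

/-- `C_{d,p}(n)`, the number of distinct `(d, p, n)`-decompositions. -/
noncomputable def hyperCatalan (d p n : ℕ) : ℕ :=
  (decompositions d p n).ncard

/-- A dyadic partition of the unit `d`-cube: a collection of open rectangles obtained from
`{(0,1)^d}` by finitely many bisections. -/
def IsDyadicPartition (d : ℕ) (S : Set (Set (Fin d → ℝ))) : Prop :=
  ∃ m : ℕ, IsDecomp d 2 m S

/-! Any nontrivial partition has a first cut, so it is a `glue` of two smaller partitions along some
midplane `x i = 1 / 2`. The direction need not be unique. But the partitions that a given midplane
does not cross are exactly the glues in that direction (`IsDecomp.exists_glue_of_splitsAlong`), and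
each is one in only one way (`glue_inj`). Iterating over a set `J` of directions, a partition split
along all of `J` amounts to `2 ^ |J|` arbitrary partitions, at the cost of `2 ^ |J| - 1` cuts.

Let `F` count partitions by steps. Inclusion–exclusion over the three directions gives `F = 1 + 3 X
F² - 3 X³ F⁴ + X⁷ F⁸` (`splitSeries_three`). So `G = X F` satisfies `G * h(G) = X` with `h = 1 - (3
X - 3 X³ + X⁷)`, and Lagrange inversion turns `n` times the `n`-th coefficient of `G` into a
coefficient of `h⁻¹ ^ n`, which the binomial theorems expand. Counting by boxes is the same as
counting by steps, since every step adds one box (`IsDecomp.encard_eq`). -/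

section DyadicPartitions

open Set

/-- The affine map that halves the `i`-th coordinate towards `ε`: for `ε = 0` and `ε = 1` it maps
the unit cube onto its lower and upper half in direction `i`. -/
noncomputable def squeeze {d : ℕ} (i : Fin d) (ε : ℝ) (x : Fin d → ℝ) : Fin d → ℝ :=
  Function.update x i ((x i + ε) / 2)

/-- Its inverse. -/
noncomputable def stretch {d : ℕ} (i : Fin d) (ε : ℝ) (x : Fin d → ℝ) : Fin d → ℝ :=
  Function.update x i (2 * x i - ε)

/-! ### Affine maps onto half cubes -/

section Squeeze

variable {d : ℕ} (i : Fin d) (ε : ℝ)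

lemma squeeze_self (x : Fin d → ℝ) : squeeze i ε x i = (x i + ε) / 2 := by simp [squeeze]

lemma squeeze_of_ne {j : Fin d} (h : j ≠ i) (x : Fin d → ℝ) : squeeze i ε x j = x j := by
  simp [squeeze, h]

lemma stretch_self (x : Fin d → ℝ) : stretch i ε x i = 2 * x i - ε := by simp [stretch]

lemma stretch_of_ne {j : Fin d} (h : j ≠ i) (x : Fin d → ℝ) : stretch i ε x j = x j := by
  simp [stretch, h]

lemma squeeze_stretch (x : Fin d → ℝ) : squeeze i ε (stretch i ε x) = x := by
  ext k
  rcases eq_or_ne k i with rfl | h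
  · rw [squeeze_self, stretch_self]; ring
  · rw [squeeze_of_ne _ _ h, stretch_of_ne _ _ h]

lemma stretch_squeeze (x : Fin d → ℝ) : stretch i ε (squeeze i ε x) = x := by
  ext k
  rcases eq_or_ne k i with rfl | h
  · rw [stretch_self, squeeze_self]; ring
  · rw [stretch_of_ne _ _ h, squeeze_of_ne _ _ h]

lemma squeeze_injective : Function.Injective (squeeze i ε) :=
  Function.LeftInverse.injective (stretch_squeeze i ε)

lemma stretch_lt {a b : Fin d → ℝ} (h : ∀ k, a k < b k) (k : Fin d) :
    stretch i ε a k < stretch i ε b k := by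
  rcases eq_or_ne k i with rfl | hk
  · rw [stretch_self, stretch_self]; linarith [h k]
  · rw [stretch_of_ne _ _ hk, stretch_of_ne _ _ hk]; exact h k

lemma squeeze_lt {a b : Fin d → ℝ} (h : ∀ k, a k < b k) (k : Fin d) :
    squeeze i ε a k < squeeze i ε b k := by
  rcases eq_or_ne k i with rfl | hk
  · rw [squeeze_self, squeeze_self]; linarith [h k]
  · rw [squeeze_of_ne _ _ hk, squeeze_of_ne _ _ hk]; exact h k

lemma squeeze_comm {j : Fin d} (h : j ≠ i) (δ : ℝ) (x : Fin d → ℝ) :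
    squeeze i ε (squeeze j δ x) = squeeze j δ (squeeze i ε x) := by
  ext k
  rcases eq_or_ne k i with rfl | hk
  · simp only [squeeze_self, squeeze_of_ne _ _ h.symm]
  · rcases eq_or_ne k j with rfl | hk'
    · simp only [squeeze_self, squeeze_of_ne _ _ hk]
    · simp only [squeeze_of_ne _ _ hk, squeeze_of_ne _ _ hk']

end Squeeze

/-! ### Boxes, their corners and their bisections -/

section Rect

variable {d : ℕ}

lemma mem_openRect {a b x : Fin d → ℝ} : x ∈ openRect a b ↔ ∀ k, a k < x k ∧ x k < b k := by
  simp [openRect]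

lemma openRect_nonempty {a b : Fin d → ℝ} (h : ∀ k, a k < b k) : (openRect a b).Nonempty := by
  simpa [openRect, Set.univ_pi_nonempty_iff] using h

/-- The corners are the infima and suprema of the coordinate projections. This identifies the
corners named by a step that cuts the unit cube. -/
lemma openRect_inj {a b a' b' : Fin d → ℝ} (h : ∀ k, a k < b k)
    (he : openRect a b = openRect a' b') : a = a' ∧ b = b' := by
  have hne := openRect_nonempty h
  have hne' := he ▸ hne
  have key : ∀ k, Ioo (a k) (b k) = Ioo (a' k) (b' k) := fun k => by
    have h1 := Set.eval_image_univ_pi (t := fun i => Ioo (a i) (b i)) (i := k) hne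
    have h2 := Set.eval_image_univ_pi (t := fun i => Ioo (a' i) (b' i)) (i := k) hne'
    rw [← h1, ← h2]
    exact congrArg _ he
  have h' : ∀ k, a' k < b' k := fun k => by
    rw [← Set.nonempty_Ioo, ← key k]; exact Set.nonempty_Ioo.2 (h k)
  constructor <;> ext k
  · rw [← csInf_Ioo (h k), key k, csInf_Ioo (h' k)]
  · rw [← csSup_Ioo (h k), key k, csSup_Ioo (h' k)]

lemma squeeze_mem_openRect (i : Fin d) (ε : ℝ) {a b x : Fin d → ℝ} :
    squeeze i ε x ∈ openRect (squeeze i ε a) (squeeze i ε b) ↔ x ∈ openRect a b := by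
  simp only [mem_openRect]
  refine forall_congr' fun k => ?_
  rcases eq_or_ne k i with rfl | h
  · simp only [squeeze_self]
    constructor <;> rintro ⟨h1, h2⟩ <;> constructor <;> linarith
  · simp only [squeeze_of_ne _ _ h]

lemma squeeze_image_openRect (i : Fin d) (ε : ℝ) (a b : Fin d → ℝ) :
    squeeze i ε '' openRect a b = openRect (squeeze i ε a) (squeeze i ε b) := by
  ext x
  constructor
  · rintro ⟨y, hy, rfl⟩
    exact (squeeze_mem_openRect i ε).2 hy
  · intro hx
    refine ⟨stretch i ε x, ?_, squeeze_stretch i ε x⟩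
    rw [← squeeze_mem_openRect i ε, squeeze_stretch]
    exact hx

lemma axisCut_two (i : Fin d) (a b : Fin d → ℝ) :
    axisCut 2 i a b = {openRect a (Function.update b i ((a i + b i) / 2)),
      openRect (Function.update a i ((a i + b i) / 2)) b} := by
  have h0 : cutPoint 2 (a i) (b i) 0 = a i := by simp [cutPoint]
  have h1 : cutPoint 2 (a i) (b i) 1 = (a i + b i) / 2 := by simp [cutPoint]; ring
  have h2 : cutPoint 2 (a i) (b i) 2 = b i := by simp [cutPoint]
  ext Q
  simp only [axisCut, mem_ofPred_eq, mem_insert_iff, mem_singleton_iff]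
  constructor
  · rintro ⟨j, hj1, hj2, rfl⟩
    interval_cases j
    · left; simp only [Nat.sub_self, h0, h1, Function.update_eq_self]
    · right; simp only [Nat.add_one_sub_one, h1, h2, Function.update_eq_self]
  · rintro (rfl | rfl)
    · exact ⟨1, le_rfl, one_le_two, by simp only [Nat.sub_self, h0, h1, Function.update_eq_self]⟩
    · exact ⟨2, one_le_two, le_rfl, by
        simp only [Nat.add_one_sub_one, h1, h2, Function.update_eq_self]⟩

/-- Affine maps preserve midpoints; `c` is meant to be either corner, `a` or `b`. -/
lemma squeeze_update (i j : Fin d) (ε : ℝ) (a b c : Fin d → ℝ) :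
    squeeze i ε (Function.update c j ((a j + b j) / 2)) =
      Function.update (squeeze i ε c) j ((squeeze i ε a j + squeeze i ε b j) / 2) := by
  ext k
  rcases eq_or_ne j i with rfl | h
  · rcases eq_or_ne k j with rfl | hk
    · simp only [squeeze_self, Function.update_self]; ring
    · simp only [squeeze_of_ne _ _ hk, Function.update_of_ne hk]
  · rcases eq_or_ne k j with rfl | hk
    · simp only [squeeze_of_ne _ _ h, Function.update_self]
    · rcases eq_or_ne k i with rfl | hk'
      · simp only [squeeze_self, Function.update_of_ne hk]
      · simp only [squeeze_of_ne _ _ hk', Function.update_of_ne hk]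

lemma squeeze_image_axisCut (i j : Fin d) (ε : ℝ) (a b : Fin d → ℝ) :
    image (squeeze i ε) '' axisCut 2 j a b = axisCut 2 j (squeeze i ε a) (squeeze i ε b) := by
  simp only [axisCut_two, image_pair, squeeze_image_openRect, squeeze_update]

/-- The open unit cube. -/
def unitCube (d : ℕ) : Set (Fin d → ℝ) := openRect (fun _ => 0) (fun _ => 1)

lemma axisCut_unitCube (i : Fin d) :
    axisCut 2 i (fun _ => 0) (fun _ => 1) =
      {squeeze i 0 '' unitCube d, squeeze i 1 '' unitCube d} := by
  have h0 : squeeze i 0 (fun _ => 0) = fun _ => 0 := by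
    ext k; rcases eq_or_ne k i with rfl | h
    · simp [squeeze_self]
    · simp [squeeze_of_ne _ _ h]
  have h1 : squeeze i 1 (fun _ => 1) = fun _ => 1 := by
    ext k; rcases eq_or_ne k i with rfl | h
    · simp [squeeze_self]
    · simp [squeeze_of_ne _ _ h]
  rw [axisCut_two, unitCube, squeeze_image_openRect, squeeze_image_openRect, h0, h1]
  simp [squeeze]

lemma subset_of_mem_axisCut {i : Fin d} {a b : Fin d → ℝ} (h : ∀ k, a k < b k)
    {Q : Set (Fin d → ℝ)} (hQ : Q ∈ axisCut 2 i a b) : Q.Nonempty ∧ Q ⊆ openRect a b := by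
  have hi := h i
  rw [axisCut_two] at hQ
  rcases hQ with rfl | rfl
  · refine ⟨openRect_nonempty fun k => ?_, fun x hx => mem_openRect.2 fun k => ?_⟩
    · rcases eq_or_ne k i with rfl | hk
      · rw [Function.update_self]; linarith
      · rw [Function.update_of_ne hk]; exact h k
    · have := mem_openRect.1 hx k
      rcases eq_or_ne k i with rfl | hk
      · rw [Function.update_self] at this; exact ⟨this.1, by linarith⟩
      · rwa [Function.update_of_ne hk] at this
  · refine ⟨openRect_nonempty fun k => ?_, fun x hx => mem_openRect.2 fun k => ?_⟩
    · rcases eq_or_ne k i with rfl | hk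
      · rw [Function.update_self]; linarith
      · rw [Function.update_of_ne hk]; exact h k
    · have := mem_openRect.1 hx k
      rcases eq_or_ne k i with rfl | hk
      · rw [Function.update_self] at this; exact ⟨by linarith, this.2⟩
      · rwa [Function.update_of_ne hk] at this

end Rect

/-! ### Gluing two collections along a midplane -/

section Glue

variable {d : ℕ}

/-- All members of the collection are nonempty and lie in the unit cube. -/
def InUnitCube (S : Set (Set (Fin d → ℝ))) : Prop :=
  ∀ Q ∈ S, Q.Nonempty ∧ Q ⊆ unitCube d

/-- The hyperplane `x i = 1 / 2` crosses no member of the collection. -/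
def SplitsAlong (i : Fin d) (S : Set (Set (Fin d → ℝ))) : Prop :=
  ∀ Q ∈ S, (∀ x ∈ Q, x i < 1 / 2) ∨ (∀ x ∈ Q, 1 / 2 < x i)

/-- The collection squeezed into a half of the unit cube. -/
def squeezeColl (i : Fin d) (ε : ℝ) (S : Set (Set (Fin d → ℝ))) : Set (Set (Fin d → ℝ)) :=
  image (squeeze i ε) '' S

/-- Two collections put into the lower and the upper half of the unit cube. -/
def glue (i : Fin d) (A B : Set (Set (Fin d → ℝ))) : Set (Set (Fin d → ℝ)) :=
  squeezeColl i 0 A ∪ squeezeColl i 1 B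

lemma image_squeeze_injective (i : Fin d) (ε : ℝ) : Function.Injective (image (squeeze i ε)) :=
  (squeeze_injective i ε).image_injective

lemma mem_squeezeColl {i : Fin d} {ε : ℝ} {A : Set (Set (Fin d → ℝ))} {Q : Set (Fin d → ℝ)} :
    squeeze i ε '' Q ∈ squeezeColl i ε A ↔ Q ∈ A :=
  (image_squeeze_injective i ε).mem_set_image

lemma openRect_mem_squeezeColl {i : Fin d} {ε : ℝ} {A : Set (Set (Fin d → ℝ))}
    {a b : Fin d → ℝ} :
    openRect a b ∈ squeezeColl i ε A ↔ openRect (stretch i ε a) (stretch i ε b) ∈ A := by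
  rw [← mem_squeezeColl (i := i) (ε := ε) (A := A), squeeze_image_openRect, squeeze_stretch,
    squeeze_stretch]

lemma InUnitCube.lt_half {i : Fin d} {A : Set (Set (Fin d → ℝ))} (hA : InUnitCube A)
    {Q : Set (Fin d → ℝ)} (hQ : Q ∈ squeezeColl i 0 A) : Q.Nonempty ∧ ∀ x ∈ Q, x i < 1 / 2 := by
  obtain ⟨R, hR, rfl⟩ := hQ
  refine ⟨(hA R hR).1.image _, ?_⟩
  rintro _ ⟨x, hx, rfl⟩
  have := (mem_openRect.1 ((hA R hR).2 hx) i).2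
  rw [squeeze_self]; linarith

lemma InUnitCube.half_lt {i : Fin d} {A : Set (Set (Fin d → ℝ))} (hA : InUnitCube A)
    {Q : Set (Fin d → ℝ)} (hQ : Q ∈ squeezeColl i 1 A) : Q.Nonempty ∧ ∀ x ∈ Q, 1 / 2 < x i := by
  obtain ⟨R, hR, rfl⟩ := hQ
  refine ⟨(hA R hR).1.image _, ?_⟩
  rintro _ ⟨x, hx, rfl⟩
  have := (mem_openRect.1 ((hA R hR).2 hx) i).1
  rw [squeeze_self]; linarith

/-- Nonemptiness of the members matters here: the empty set would lie on both sides of the midplane.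
-/
lemma disjoint_squeezeColl (i : Fin d) {A B : Set (Set (Fin d → ℝ))} (hA : InUnitCube A)
    (hB : InUnitCube B) : Disjoint (squeezeColl i 0 A) (squeezeColl i 1 B) := by
  rw [Set.disjoint_left]
  intro Q h0 h1
  obtain ⟨⟨x, hx⟩, h⟩ := hA.lt_half h0
  exact absurd (h x hx) (not_lt.2 ((hB.half_lt h1).2 x hx).le)

lemma glue_inj {i : Fin d} {A B A' B' : Set (Set (Fin d → ℝ))} (hA : InUnitCube A)
    (hB : InUnitCube B) (hA' : InUnitCube A') (hB' : InUnitCube B')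
    (h : glue i A B = glue i A' B') : A = A' ∧ B = B' := by
  have d1 := Set.disjoint_left.1 (disjoint_squeezeColl i hA hB')
  have d2 := Set.disjoint_left.1 (disjoint_squeezeColl i hA' hB)
  have d3 := Set.disjoint_left.1 (disjoint_squeezeColl i hA hB)
  have d4 := Set.disjoint_left.1 (disjoint_squeezeColl i hA' hB')
  have e := Set.ext_iff.1 h
  have h0 : squeezeColl i 0 A = squeezeColl i 0 A' := by
    ext Q
    have := e Q
    simp only [glue, mem_union] at this
    have := d1 (a := Q)
    have := d2 (a := Q)
    tauto
  have h1 : squeezeColl i 1 B = squeezeColl i 1 B' := by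
    ext Q
    have := e Q
    simp only [glue, mem_union] at this
    have := d1 (a := Q)
    have := d2 (a := Q)
    have := d3 (a := Q)
    have := d4 (a := Q)
    tauto
  exact ⟨(image_squeeze_injective i 0).image_injective h0,
    (image_squeeze_injective i 1).image_injective h1⟩

lemma splitsAlong_glue_self (i : Fin d) {A B : Set (Set (Fin d → ℝ))} (hA : InUnitCube A)
    (hB : InUnitCube B) : SplitsAlong i (glue i A B) := by
  rintro Q (hQ | hQ)
  · exact Or.inl (hA.lt_half hQ).2
  · exact Or.inr (hB.half_lt hQ).2

lemma splitsAlong_squeezeColl {i j : Fin d} (h : j ≠ i) (ε : ℝ) (A : Set (Set (Fin d → ℝ))) :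
    SplitsAlong j (squeezeColl i ε A) ↔ SplitsAlong j A := by
  simp only [SplitsAlong, squeezeColl, forall_mem_image, squeeze_of_ne _ _ h]

lemma splitsAlong_glue {i j : Fin d} (h : j ≠ i) (A B : Set (Set (Fin d → ℝ))) :
    SplitsAlong j (glue i A B) ↔ SplitsAlong j A ∧ SplitsAlong j B := by
  rw [← splitsAlong_squeezeColl h 0 A, ← splitsAlong_squeezeColl h 1 B]
  simp only [SplitsAlong, glue, mem_union, or_imp, forall_and]

lemma squeezeColl_comm {i j : Fin d} (h : j ≠ i) (ε δ : ℝ) (A : Set (Set (Fin d → ℝ))) :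
    squeezeColl i ε (squeezeColl j δ A) = squeezeColl j δ (squeezeColl i ε A) := by
  simp only [squeezeColl, image_image, squeeze_comm i ε h δ]

/-- Four quarters can be assembled in either order. This is the only source of coincidences between
different cutting orders. -/
lemma glue_glue_comm {i j : Fin d} (h : j ≠ i) (A B A' B' : Set (Set (Fin d → ℝ))) :
    glue j (glue i A B) (glue i A' B') = glue i (glue j A A') (glue j B B') := by
  have hu : ∀ (k : Fin d) (ε : ℝ) (S T : Set (Set (Fin d → ℝ))),
      squeezeColl k ε (S ∪ T) = squeezeColl k ε S ∪ squeezeColl k ε T :=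
    fun k ε S T => image_union _ _ _
  simp only [glue, hu, squeezeColl_comm h]
  exact Set.union_union_union_comm _ _ _ _

lemma squeezeColl_step (i j : Fin d) (ε : ℝ) (A : Set (Set (Fin d → ℝ))) (a b : Fin d → ℝ) :
    squeezeColl i ε ((A \ {openRect a b}) ∪ axisCut 2 j a b) =
      (squeezeColl i ε A \ {openRect (squeeze i ε a) (squeeze i ε b)}) ∪
        axisCut 2 j (squeeze i ε a) (squeeze i ε b) := by
  rw [squeezeColl, image_union, squeeze_image_axisCut, image_sdiff (image_squeeze_injective i ε),
    image_singleton, squeeze_image_openRect, squeezeColl]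

lemma union_step_left {α : Type*} {X Y c : Set α} {R : α} (hR : R ∉ Y) :
    ((X ∪ Y) \ {R}) ∪ c = ((X \ {R}) ∪ c) ∪ Y := by
  rw [union_sdiff_distrib, sdiff_singleton_eq_self hR, union_right_comm]

lemma union_step_right {α : Type*} {X Y c : Set α} {R : α} (hR : R ∉ X) :
    ((X ∪ Y) \ {R}) ∪ c = X ∪ ((Y \ {R}) ∪ c) := by
  rw [union_sdiff_distrib, sdiff_singleton_eq_self hR, union_assoc]

end Glue

/-! ### Recursive structure of dyadic partitions -/

section Decomp

variable {d : ℕ}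

lemma IsDecomp.inUnitCube {m : ℕ} {S : Set (Set (Fin d → ℝ))} (hS : IsDecomp d 2 m S) :
    InUnitCube S := by
  induction hS with
  | unit =>
    rintro Q rfl
    exact ⟨openRect_nonempty fun _ => one_pos, subset_rfl⟩
  | step a b i hS hab hR ih =>
    rintro Q (hQ | hQ)
    · exact ih Q hQ.1
    · have := subset_of_mem_axisCut hab hQ
      exact ⟨this.1, this.2.trans (ih _ hR).2⟩

lemma IsDecomp.glue_unit (i : Fin d) :
    IsDecomp d 2 1 (glue i {unitCube d} {unitCube d}) := by
  have := IsDecomp.step (fun _ => 0) (fun _ => 1) i (IsDecomp.unit (d := d) (p := 2))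
    (fun _ => one_pos) rfl
  rwa [sdiff_self, axisCut_unitCube, empty_union, ← singleton_union,
    ← image_singleton, ← image_singleton (f := image (squeeze i 1))] at this

/-- Cut the cube once, then replay the steps of `A` in the lower half and those of `B` in the upper
half. -/
lemma IsDecomp.glue (i : Fin d) {k l : ℕ} {A B : Set (Set (Fin d → ℝ))}
    (hA : IsDecomp d 2 k A) (hB : IsDecomp d 2 l B) : IsDecomp d 2 (k + l + 1) (glue i A B) := by
  induction hB with
  | unit =>
    induction hA with
    | unit => exact IsDecomp.glue_unit i
    | @step m S a b j hS hab hR ih =>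
      have hmem : openRect (squeeze i 0 a) (squeeze i 0 b) ∈ squeezeColl i 0 S := by
        rwa [← squeeze_image_openRect, mem_squeezeColl]
      have hn := Set.disjoint_left.1
        (disjoint_squeezeColl i hS.inUnitCube (IsDecomp.unit (d := d) (p := 2)).inUnitCube) hmem
      have := IsDecomp.step _ _ j ih (squeeze_lt i 0 hab) (Or.inl hmem)
      rw [_root_.glue, union_step_left hn, ← squeezeColl_step] at this
      rwa [Nat.add_right_comm m 1 0]
  | @step m S a b j hS hab hR ih =>
    have hmem : openRect (squeeze i 1 a) (squeeze i 1 b) ∈ squeezeColl i 1 S := by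
      rwa [← squeeze_image_openRect, mem_squeezeColl]
    have hn := Set.disjoint_right.1 (disjoint_squeezeColl i hA.inUnitCube hS.inUnitCube) hmem
    have := IsDecomp.step _ _ j ih (squeeze_lt i 1 hab) (Or.inr hmem)
    rw [_root_.glue, union_step_right hn, ← squeezeColl_step] at this
    exact this

/-- The first cut persists: each later step acts inside one half, and `stretch` carries it back to a
step on the cube. -/
lemma IsDecomp.eq_unit_or_glue {m : ℕ} {S : Set (Set (Fin d → ℝ))} (hS : IsDecomp d 2 m S) :
    (m = 0 ∧ S = {unitCube d}) ∨ ∃ (i : Fin d) (k l : ℕ) (A B : Set (Set (Fin d → ℝ))),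
      k + l + 1 = m ∧ IsDecomp d 2 k A ∧ IsDecomp d 2 l B ∧ S = _root_.glue i A B := by
  induction hS with
  | unit => exact Or.inl ⟨rfl, rfl⟩
  | @step m S a b j hS hab hR ih =>
    right
    rcases ih with ⟨rfl, rfl⟩ | ⟨i, k, l, A, B, rfl, hA, hB, rfl⟩
    · obtain ⟨rfl, rfl⟩ := openRect_inj hab hR
      refine ⟨j, 0, 0, _, _, rfl, IsDecomp.unit, IsDecomp.unit, ?_⟩
      rw [axisCut_unitCube, unitCube, sdiff_self, empty_union, ← singleton_union,
        ← image_singleton, ← image_singleton (f := image (squeeze j 1))]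
      rfl
    · have dis := disjoint_squeezeColl i hA.inUnitCube hB.inUnitCube
      rcases hR with hR | hR
      · refine ⟨i, k + 1, l, _, B, by ring,
          IsDecomp.step _ _ j hA (stretch_lt i 0 hab) (openRect_mem_squeezeColl.1 hR), hB, ?_⟩
        rw [_root_.glue, _root_.glue, squeezeColl_step, squeeze_stretch, squeeze_stretch,
          union_step_left (Set.disjoint_left.1 dis hR)]
      · refine ⟨i, k, l + 1, A, _, by ring, hA,
          IsDecomp.step _ _ j hB (stretch_lt i 1 hab) (openRect_mem_squeezeColl.1 hR), ?_⟩
        rw [_root_.glue, _root_.glue, squeezeColl_step, squeeze_stretch, squeeze_stretch,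
          union_step_right (Set.disjoint_right.1 dis hR)]

lemma not_splitsAlong_unitCube (i : Fin d) : ¬ SplitsAlong i {unitCube d} := by
  intro h
  have hm : (fun _ => 1 / 2 : Fin d → ℝ) ∈ unitCube d :=
    mem_openRect.2 fun _ => by norm_num
  rcases h _ rfl with h | h <;> exact lt_irrefl _ (h _ hm)

/-- If the first cut has another direction `j`, both halves still split along `i`. By induction both
are glues along `i`, and exchanging the quarters brings the cut along `i` to the front. -/
lemma IsDecomp.exists_glue_of_splitsAlong {i : Fin d} {m : ℕ} {S : Set (Set (Fin d → ℝ))}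
    (hS : IsDecomp d 2 m S) (hi : SplitsAlong i S) :
    ∃ (k l : ℕ) (A B : Set (Set (Fin d → ℝ))),
      k + l + 1 = m ∧ IsDecomp d 2 k A ∧ IsDecomp d 2 l B ∧ S = _root_.glue i A B := by
  induction m using Nat.strong_induction_on generalizing S with
  | _ m ih =>
    rcases hS.eq_unit_or_glue with ⟨rfl, rfl⟩ | ⟨j, k, l, A, B, rfl, hA, hB, rfl⟩
    · exact absurd hi (not_splitsAlong_unitCube i)
    · rcases eq_or_ne i j with rfl | hij
      · exact ⟨k, l, A, B, rfl, hA, hB, rfl⟩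
      · rw [splitsAlong_glue hij] at hi
        obtain ⟨k₀, k₁, A₀, A₁, rfl, hA₀, hA₁, rfl⟩ := ih k (by omega) hA hi.1
        obtain ⟨l₀, l₁, B₀, B₁, rfl, hB₀, hB₁, rfl⟩ := ih l (by omega) hB hi.2
        exact ⟨_, _, _, _, by ring, hA₀.glue j hB₀, hA₁.glue j hB₁, glue_glue_comm hij.symm _ _ _ _⟩

lemma IsDecomp.encard_eq {m : ℕ} {S : Set (Set (Fin d → ℝ))} (hS : IsDecomp d 2 m S) :
    S.encard = (m + 1 : ℕ) := by
  induction m using Nat.strong_induction_on generalizing S with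
  | _ m ih =>
    rcases hS.eq_unit_or_glue with ⟨rfl, rfl⟩ | ⟨i, k, l, A, B, rfl, hA, hB, rfl⟩
    · simp
    · rw [_root_.glue, encard_union_eq (disjoint_squeezeColl i hA.inUnitCube hB.inUnitCube),
        squeezeColl, squeezeColl, (image_squeeze_injective i 0).encard_image,
        (image_squeeze_injective i 1).encard_image, ih k (by omega) hA, ih l (by omega) hB]
      push_cast
      ring

lemma IsDecomp.steps_unique {m m' : ℕ} {S : Set (Set (Fin d → ℝ))} (h : IsDecomp d 2 m S)
    (h' : IsDecomp d 2 m' S) : m = m' := by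
  have := h.encard_eq.symm.trans h'.encard_eq
  simpa using this

end Decomp

/-! ### Counting by inclusion–exclusion -/

section Count

variable {d : ℕ}

/-- The dyadic partitions obtained by `m` steps that no hyperplane `x j = 1 / 2` with `j ∈ J`
crosses. -/
def splitDecomps (J : Finset (Fin d)) (m : ℕ) : Set (Set (Set (Fin d → ℝ))) :=
  {S | IsDecomp d 2 m S ∧ ∀ j ∈ J, SplitsAlong j S}

lemma splitDecomps_insert_zero (i : Fin d) (J : Finset (Fin d)) :
    splitDecomps (insert i J) 0 = ∅ := by
  refine eq_empty_of_forall_notMem fun S hS => ?_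
  obtain ⟨k, l, A, B, h, -⟩ :=
    hS.1.exists_glue_of_splitsAlong (hS.2 i (Finset.mem_insert_self i J))
  omega

lemma splitDecomps_insert_succ {i : Fin d} {J : Finset (Fin d)} (hi : i ∉ J) (m : ℕ) :
    splitDecomps (insert i J) (m + 1) = (fun AB => glue i AB.1 AB.2) ''
      ⋃ kl ∈ Finset.HasAntidiagonal.antidiagonal m, splitDecomps J kl.1 ×ˢ splitDecomps J kl.2 := by
  have hne : ∀ j ∈ J, j ≠ i := fun j hj h => hi (h ▸ hj)
  ext S
  simp only [mem_image, mem_iUnion, mem_prod, Prod.exists, exists_prop,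
    Finset.HasAntidiagonal.mem_antidiagonal]
  constructor
  · rintro ⟨hS, hJ⟩
    obtain ⟨k, l, A, B, h, hA, hB, rfl⟩ :=
      hS.exists_glue_of_splitsAlong (hJ i (Finset.mem_insert_self i J))
    have hJ' := fun j hj => (splitsAlong_glue (hne j hj) A B).1
      (hJ j (Finset.mem_insert_of_mem hj))
    exact ⟨A, B, ⟨k, l, by omega, ⟨hA, fun j hj => (hJ' j hj).1⟩, hB, fun j hj => (hJ' j hj).2⟩,
      rfl⟩
  · rintro ⟨A, B, ⟨k, l, rfl, ⟨hA, hAJ⟩, hB, hBJ⟩, rfl⟩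
    refine ⟨hA.glue i hB, fun j hj => ?_⟩
    rcases Finset.mem_insert.1 hj with rfl | hj
    · exact splitsAlong_glue_self j hA.inUnitCube hB.inUnitCube
    · exact (splitsAlong_glue (hne j hj) A B).2 ⟨hAJ j hj, hBJ j hj⟩

lemma splitDecomps_empty_succ (m : ℕ) :
    splitDecomps (∅ : Finset (Fin d)) (m + 1) = ⋃ i, splitDecomps {i} (m + 1) := by
  ext S
  simp only [mem_iUnion]
  constructor
  · rintro ⟨hS, -⟩
    rcases hS.eq_unit_or_glue with ⟨h, -⟩ | ⟨i, k, l, A, B, -, hA, hB, rfl⟩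
    · omega
    · refine ⟨i, hS, fun j hj => ?_⟩
      rw [Finset.mem_singleton.1 hj]
      exact splitsAlong_glue_self i hA.inUnitCube hB.inUnitCube
  · rintro ⟨i, hS, -⟩
    exact ⟨hS, by simp⟩

lemma splitDecomps_empty_zero :
    splitDecomps (∅ : Finset (Fin d)) 0 = {{unitCube d}} := by
  ext S
  constructor
  · rintro ⟨hS, -⟩
    rcases hS.eq_unit_or_glue with ⟨-, rfl⟩ | ⟨i, k, l, A, B, h, -⟩
    · rfl
    · omega
  · rintro rfl
    exact ⟨IsDecomp.unit, by simp⟩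

lemma splitDecomps_finite (J : Finset (Fin d)) (m : ℕ) : (splitDecomps J m).Finite := by
  suffices h : (splitDecomps (∅ : Finset (Fin d)) m).Finite from
    h.subset fun S hS => ⟨hS.1, by simp⟩
  induction m using Nat.strong_induction_on with
  | _ m ih =>
    rcases m with _ | m
    · rw [splitDecomps_empty_zero]; exact finite_singleton _
    · rw [splitDecomps_empty_succ]
      refine finite_iUnion fun i => ?_
      rw [← insert_empty_eq, splitDecomps_insert_succ (Finset.notMem_empty i)]
      refine Set.Finite.image _ (Set.Finite.biUnion (Finset.finite_toSet _) fun kl hkl => ?_)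
      have := Finset.HasAntidiagonal.mem_antidiagonal.1 (Finset.mem_coe.1 hkl)
      exact (ih _ (by omega)).prod (ih _ (by omega))

/-- No pair is counted twice, because a partition determines its number of steps; no glue is, by
`glue_inj`. -/
lemma splitDecomps_ncard_insert {i : Fin d} {J : Finset (Fin d)} (hi : i ∉ J) (m : ℕ) :
    (splitDecomps (insert i J) (m + 1)).ncard = ∑ kl ∈ Finset.HasAntidiagonal.antidiagonal m,
      (splitDecomps J kl.1).ncard * (splitDecomps J kl.2).ncard := by
  classical
  rw [splitDecomps_insert_succ hi, InjOn.ncard_image]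
  · have hf := fun kl : ℕ × ℕ => (splitDecomps_finite J kl.1).prod (splitDecomps_finite J kl.2)
    have he : (⋃ kl ∈ Finset.HasAntidiagonal.antidiagonal m, splitDecomps J kl.1 ×ˢ splitDecomps J kl.2) =
        ((Finset.HasAntidiagonal.antidiagonal m).biUnion fun kl => (hf kl).toFinset : Finset _) := by
      simp
    rw [he, ncard_coe_finset, Finset.card_biUnion]
    · refine Finset.sum_congr rfl fun kl _ => ?_
      rw [← ncard_eq_toFinset_card _ (hf kl), ncard_prod]
    · intro kl _ kl' _ hne
      rw [Function.onFun, Finset.disjoint_left]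
      intro AB h h'
      rw [Set.Finite.mem_toFinset] at h h'
      exact hne (Prod.ext (h.1.1.steps_unique h'.1.1) (h.2.1.steps_unique h'.2.1))
  · intro AB h AB' h' he
    simp only [mem_iUnion] at h h'
    obtain ⟨_, _, h⟩ := h
    obtain ⟨_, _, h'⟩ := h'
    have := glue_inj h.1.1.inUnitCube h.2.1.inUnitCube h'.1.1.inUnitCube h'.2.1.inUnitCube he
    exact Prod.ext this.1 this.2

/-- The generating function of `splitDecomps J` by the number of steps. -/
noncomputable def splitSeries (J : Finset (Fin d)) : PowerSeries ℚ :=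
  PowerSeries.mk fun m => ((splitDecomps J m).ncard : ℚ)

lemma splitSeries_insert {i : Fin d} {J : Finset (Fin d)} (hi : i ∉ J) :
    splitSeries (insert i J) = PowerSeries.X * splitSeries J ^ 2 := by
  ext m
  rcases m with _ | m
  · simp [splitSeries, splitDecomps_insert_zero]
  · rw [PowerSeries.coeff_succ_X_mul, sq, PowerSeries.coeff_mul]
    simp only [splitSeries, PowerSeries.coeff_mk, splitDecomps_ncard_insert hi]
    push_cast
    rfl

lemma splitDecomps_inter (J K : Finset (Fin d)) (m : ℕ) :
    splitDecomps J m ∩ splitDecomps K m = splitDecomps (J ∪ K) m := by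
  ext S
  simp only [splitDecomps, mem_inter_iff, mem_ofPred_eq, Finset.mem_union, or_imp, forall_and]
  tauto

lemma Set.ncard_union_three {α : Type*} {A B C : Set α} (hA : A.Finite) (hB : B.Finite)
    (hC : C.Finite) : (A ∪ B ∪ C).ncard + (A ∩ B).ncard + (A ∩ C).ncard + (B ∩ C).ncard =
      A.ncard + B.ncard + C.ncard + (A ∩ B ∩ C).ncard := by
  have h1 := ncard_union_add_ncard_inter A B hA hB
  have h2 := ncard_union_add_ncard_inter (A ∪ B) C (hA.union hB) hC
  have h3 := ncard_union_add_ncard_inter (A ∩ C) (B ∩ C) (hA.inter_of_left _) (hB.inter_of_left _)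
  rw [← union_inter_distrib_right, ← inter_inter_distrib_right] at h3
  omega

lemma splitSeries_three : splitSeries (∅ : Finset (Fin 3)) =
    1 + 3 * (PowerSeries.X * splitSeries (∅ : Finset (Fin 3)) ^ 2)
      - 3 * (PowerSeries.X ^ 3 * splitSeries (∅ : Finset (Fin 3)) ^ 4)
      + PowerSeries.X ^ 7 * splitSeries (∅ : Finset (Fin 3)) ^ 8 := by
  have s1 : ∀ i : Fin 3, splitSeries {i} = PowerSeries.X * splitSeries (∅ : Finset (Fin 3)) ^ 2 :=
    fun i => by rw [← insert_empty_eq, splitSeries_insert (Finset.notMem_empty i)]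
  have s2 : ∀ i j : Fin 3, i ≠ j → splitSeries {i, j} =
      PowerSeries.X ^ 3 * splitSeries (∅ : Finset (Fin 3)) ^ 4 := fun i j h => by
    rw [splitSeries_insert (by simpa using h), s1]; ring
  have s3 : splitSeries {(0 : Fin 3), 1, 2} =
      PowerSeries.X ^ 7 * splitSeries (∅ : Finset (Fin 3)) ^ 8 := by
    rw [splitSeries_insert (by decide), s2 1 2 (by decide)]; ring
  -- Inclusion–exclusion without subtraction. The `1` is the uncut cube, which splits along no
  -- direction.
  have key : splitSeries (∅ : Finset (Fin 3)) + splitSeries {(0 : Fin 3), 1} +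
      splitSeries {(0 : Fin 3), 2} + splitSeries {(1 : Fin 3), 2} =
      1 + splitSeries {(0 : Fin 3)} + splitSeries {(1 : Fin 3)} + splitSeries {(2 : Fin 3)} +
      splitSeries {(0 : Fin 3), 1, 2} := by
    ext m
    rcases m with _ | m
    · simp only [splitSeries, map_add, PowerSeries.coeff_mk, splitDecomps_empty_zero,
        splitDecomps_insert_zero, ncard_singleton, ncard_empty, ← insert_empty_eq (β := Finset (Fin 3))]
      simp
    · have h := Set.ncard_union_three (splitDecomps_finite {(0 : Fin 3)} (m + 1))
        (splitDecomps_finite {1} (m + 1)) (splitDecomps_finite {2} (m + 1))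
      have hU : splitDecomps (∅ : Finset (Fin 3)) (m + 1) = splitDecomps {0} (m + 1) ∪
          splitDecomps {1} (m + 1) ∪ splitDecomps {2} (m + 1) := by
        rw [splitDecomps_empty_succ]
        ext S
        simp [Fin.exists_fin_succ, or_assoc]
      rw [← hU] at h
      simp only [splitDecomps_inter] at h
      simp only [splitSeries, map_add, PowerSeries.coeff_mk, PowerSeries.coeff_one,
        Nat.succ_ne_zero, if_false, zero_add]
      exact_mod_cast h
  rw [s1, s1, s1, s2 0 1 (by decide), s2 0 2 (by decide), s2 1 2 (by decide), s3] at key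
  linear_combination key

end Count

end DyadicPartitions

/-! ### Lagrange inversion by formal power series -/

section LagrangeInversion

open Polynomial

variable {K : Type*} [Field K]

/-- The identity is, to any order, a combination of the powers of `X * h` if `h` has nonzero
constant coefficient. -/
lemma exists_X_eq_sum_pow_add {h : K[X]} (h0 : h.coeff 0 ≠ 0) (N : ℕ) :
    ∃ (c : ℕ → K) (Q : K[X]),
      (X : K[X]) = ∑ k ∈ Finset.range (N + 1), C (c k) * (X * h) ^ k + X ^ (N + 1) * Q := by
  induction N with
  | zero => exact ⟨0, 1, by simp⟩
  | succ N ih =>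
    obtain ⟨c, Q, hQ⟩ := ih
    -- Chosen to cancel the constant term of the remainder, which then gains a factor `X`.
    set e : K := Q.coeff 0 / h.coeff 0 ^ (N + 1) with he
    have hd : X ∣ Q - C e * h ^ (N + 1) := by
      rw [X_dvd_iff, coeff_sub, coeff_C_mul, coeff_zero_eq_eval_zero (h ^ (N + 1)), eval_pow,
        ← coeff_zero_eq_eval_zero, he, div_mul_cancel₀ _ (pow_ne_zero _ h0), sub_self]
    obtain ⟨Q', hQ'⟩ := hd
    refine ⟨Function.update c (N + 1) e, Q', ?_⟩
    have hs : ∑ k ∈ Finset.range (N + 1), C (Function.update c (N + 1) e k) * (X * h) ^ k =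
        ∑ k ∈ Finset.range (N + 1), C (c k) * (X * h) ^ k :=
      Finset.sum_congr rfl fun k hk => by
        rw [Function.update_of_ne (Finset.mem_range.1 hk).ne]
    rw [Finset.sum_range_succ, hs, Function.update_self]
    linear_combination hQ + X ^ (N + 1) * hQ'

/-- For invertible `H` this is the residue of `(X H)' / (X H) ^ (m + 1)`, an exact derivative when
`m > 0`. In series terms, `m` times the expression is `m H⁻¹ ^ m - X (H⁻¹ ^ m)'`, whose `m`-th
coefficient cancels. -/
lemma coeff_inv_pow_add_derivative [CharZero K] (H : PowerSeries K) (m : ℕ) :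
    PowerSeries.coeff m
      (H⁻¹ ^ m + PowerSeries.X * PowerSeries.derivative K H * H⁻¹ ^ (m + 1)) =
      if m = 0 then 1 else 0 := by
  rcases m with _ | m
  · simp
  · have hD : PowerSeries.derivative K (H⁻¹ ^ (m + 1)) =
        -((m + 1 : ℕ) : PowerSeries K) * (PowerSeries.derivative K H * H⁻¹ ^ (m + 2)) := by
      rw [PowerSeries.derivative_pow, PowerSeries.derivative_inv', Nat.add_sub_cancel]
      ring
    have hc : (((m + 1 : ℕ) : K)) ≠ 0 := Nat.cast_ne_zero.2 (Nat.succ_ne_zero m)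
    have hcoe : ((m + 1 : ℕ) : PowerSeries K) = PowerSeries.C ((m + 1 : ℕ) : K) := by simp
    have h1 : PowerSeries.C ((m + 1 : ℕ) : K) *
        (H⁻¹ ^ (m + 1) + PowerSeries.X * PowerSeries.derivative K H * H⁻¹ ^ (m + 1 + 1)) =
        PowerSeries.C ((m + 1 : ℕ) : K) * H⁻¹ ^ (m + 1) -
          PowerSeries.X * PowerSeries.derivative K (H⁻¹ ^ (m + 1)) := by
      rw [hD, hcoe]; ring
    have h2 := congrArg (PowerSeries.coeff (m + 1)) h1
    rw [PowerSeries.coeff_C_mul, map_sub, PowerSeries.coeff_C_mul, PowerSeries.coeff_succ_X_mul,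
      PowerSeries.coeff_derivative] at h2
    rw [if_neg (Nat.succ_ne_zero m)]
    refine (mul_eq_zero.1 (h2.trans ?_)).resolve_left hc
    push_cast
    ring

/-- Lagrange inversion for `F * h(F) = X` with a polynomial `h`. -/
theorem lagrange_inversion [CharZero K] {h : K[X]} (h0 : h.coeff 0 ≠ 0)
    {F : PowerSeries K} (hF0 : PowerSeries.constantCoeff F = 0)
    (hF : F * aeval F h = PowerSeries.X) (n : ℕ) :
    ((n + 1 : ℕ) : K) * PowerSeries.coeff (n + 1) F =
      PowerSeries.coeff n ((h : PowerSeries K)⁻¹ ^ (n + 1)) := by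
  -- The coefficient `c (n + 1)` is read off twice: substituting `F` turns `X * h` into `X`, so it
  -- is a coefficient of `F`; differentiating and multiplying by `H⁻¹ ^ (n + 1)` isolates it by
  -- residues.
  obtain ⟨c, Q, hQ⟩ := exists_X_eq_sum_pow_add h0 (n + 1)
  have hc : PowerSeries.coeff (n + 1) F = c (n + 1) := by
    obtain ⟨G, hG⟩ := PowerSeries.X_dvd_iff.2 hF0
    have := congrArg (aeval F) hQ
    simp only [map_add, map_sum, map_mul, map_pow, aeval_X, aeval_C, hF] at this
    have h2 := congrArg (PowerSeries.coeff (n + 1)) this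
    have h3 : PowerSeries.coeff (n + 1) (F ^ (n + 1 + 1) * aeval F Q) = 0 := by
      have : F ^ (n + 1 + 1) * aeval F Q =
          PowerSeries.X ^ (n + 1 + 1) * (G ^ (n + 1 + 1) * aeval F Q) := by
        rw [hG, mul_pow, mul_assoc, ← hG]
      rw [this, PowerSeries.coeff_X_pow_mul', if_neg (by omega)]
    rw [h2, map_add, h3, add_zero, map_sum, Finset.sum_eq_single_of_mem (n + 1) (by simp)]
    · rw [← PowerSeries.C_eq_algebraMap, PowerSeries.coeff_C_mul, PowerSeries.coeff_X_pow_self, mul_one]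
    · intro k _ hk
      rw [← PowerSeries.C_eq_algebraMap, PowerSeries.coeff_C_mul, PowerSeries.coeff_X_pow,
        if_neg hk.symm, mul_zero]
  set H : PowerSeries K := (h : PowerSeries K) with hH
  have hH0 : PowerSeries.constantCoeff H ≠ 0 := by
    rwa [hH, ← PowerSeries.coeff_zero_eq_constantCoeff_apply, Polynomial.coeff_coe]
  have hHI : H * H⁻¹ = 1 := PowerSeries.mul_inv_cancel H hH0
  have hQH := congrArg (fun p : K[X] => PowerSeries.derivative K (p : PowerSeries K)) hQ
  have hcoe : ((∑ k ∈ Finset.range (n + 1 + 1), C (c k) * (X * h) ^ k : K[X]) : PowerSeries K) =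
      ∑ k ∈ Finset.range (n + 1 + 1), PowerSeries.C (c k) * (PowerSeries.X * H) ^ k := by
    rw [← Polynomial.coeToPowerSeries.ringHom_apply, map_sum]
    simp [hH]
  simp only [Polynomial.coe_add, hcoe, Polynomial.coe_mul, Polynomial.coe_pow, Polynomial.coe_X,
    map_add, map_sum, PowerSeries.derivative_X] at hQH
  -- Pulling out `X ^ k` leaves the coefficient of order `n - k` from the residue lemma, so only `k
  -- = n` survives.
  have hterm : ∀ k ∈ Finset.range (n + 1), PowerSeries.coeff n (PowerSeries.derivative K
      (PowerSeries.C (c (k + 1)) * (PowerSeries.X * H) ^ (k + 1)) * H⁻¹ ^ (n + 1)) =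
      c (k + 1) * ((k + 1 : ℕ) : K) * if n - k = 0 then 1 else 0 := by
    intro k hk
    have hkn : k ≤ n := Nat.lt_succ_iff.1 (Finset.mem_range.1 hk)
    obtain ⟨m, rfl⟩ := Nat.exists_eq_add_of_le hkn
    have hp : H ^ k * H⁻¹ ^ k = 1 := by rw [← mul_pow, hHI, one_pow]
    have : PowerSeries.derivative K (PowerSeries.C (c (k + 1)) * (PowerSeries.X * H) ^ (k + 1)) *
        H⁻¹ ^ (k + m + 1) = PowerSeries.C (c (k + 1) * ((k + 1 : ℕ) : K)) * (PowerSeries.X ^ k *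
          (H⁻¹ ^ m + PowerSeries.X * PowerSeries.derivative K H * H⁻¹ ^ (m + 1))) := by
      rw [Derivation.leibniz, PowerSeries.derivative_C, PowerSeries.derivative_pow,
        Derivation.leibniz, PowerSeries.derivative_X, Nat.add_sub_cancel, map_mul, map_natCast]
      simp only [smul_eq_mul]
      have e1 : H ^ k * H⁻¹ ^ (k + m + 1) = H⁻¹ ^ (m + 1) := by
        rw [add_assoc, pow_add, ← mul_assoc, hp, one_mul]
      have e2 : H * H⁻¹ ^ (m + 1) = H⁻¹ ^ m := by rw [pow_succ', ← mul_assoc, hHI, one_mul]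
      rw [← e2, ← e1]
      ring
    rw [this, PowerSeries.coeff_C_mul, PowerSeries.coeff_X_pow_mul', if_pos hkn,
      Nat.add_sub_cancel_left, coeff_inv_pow_add_derivative]
  have hrem : PowerSeries.coeff n (PowerSeries.derivative K
      (PowerSeries.X ^ (n + 1 + 1) * (Q : PowerSeries K)) * H⁻¹ ^ (n + 1)) = 0 := by
    rw [Derivation.leibniz, PowerSeries.derivative_pow, PowerSeries.derivative_X,
      Nat.add_sub_cancel]
    simp only [smul_eq_mul]
    have : ∀ A B D E : PowerSeries K,
        (PowerSeries.X ^ (n + 1 + 1) * A + B * (D * PowerSeries.X ^ (n + 1) * 1)) * E =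
          PowerSeries.X ^ (n + 1) * ((PowerSeries.X * A + B * D) * E) := fun A B D E => by ring
    rw [this, PowerSeries.coeff_X_pow_mul', if_neg (by omega)]
  have key := congrArg (fun f => PowerSeries.coeff n (f * H⁻¹ ^ (n + 1))) hQH
  simp only [one_mul, add_mul, Finset.sum_mul, map_add, map_sum, hrem, add_zero] at key
  rw [key, Finset.sum_range_succ', Finset.sum_congr rfl hterm, hc,
    Finset.sum_eq_single_of_mem n (by simp)]
  · simp [mul_comm]
  · intro k hk hkn
    have := Finset.mem_range.1 hk
    rw [if_neg (by omega), mul_zero]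

end LagrangeInversion

/-! ### Expanding the coefficients of the inverse power -/

section Coefficients

open PowerSeries

/-- Negative binomial series, with `u` substituted for the variable. -/
lemma PowerSeries.inv_one_sub_pow_eq_subst {u : PowerSeries ℚ} (hu : constantCoeff u = 0) (d : ℕ) :
    (1 - u)⁻¹ ^ (d + 1) = (PowerSeries.mk fun k => ((d + k).choose d : ℚ)).subst u := by
  have hs : HasSubst u := HasSubst.of_constantCoeff_zero' hu
  have h := congrArg (substAlgHom hs) (mk_add_choose_mul_one_sub_pow_eq_one ℚ d)
  rw [map_mul, map_pow, map_sub, map_one, substAlgHom_X, coe_substAlgHom] at h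
  have h1 : (1 - u) * (1 - u)⁻¹ = 1 := PowerSeries.mul_inv_cancel _ (by simp [hu])
  calc (1 - u)⁻¹ ^ (d + 1)
      = ((PowerSeries.mk fun k => ((d + k).choose d : ℚ)).subst u * (1 - u) ^ (d + 1)) *
          (1 - u)⁻¹ ^ (d + 1) := by rw [h, one_mul]
    _ = _ := by rw [mul_assoc, ← mul_pow, h1, one_pow, mul_one]

lemma PowerSeries.coeff_inv_one_sub_pow {u : PowerSeries ℚ} (hu : constantCoeff u = 0)
    (d n : ℕ) : coeff n ((1 - u)⁻¹ ^ (d + 1)) =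
      ∑ k ∈ Finset.range (n + 1), ((d + k).choose d : ℚ) * coeff n (u ^ k) := by
  rw [inv_one_sub_pow_eq_subst hu, coeff_subst' (HasSubst.of_constantCoeff_zero' hu),
    finsum_eq_sum_of_support_subset (s := Finset.range (n + 1))]
  · simp
  · intro k hk
    by_contra hkn
    refine hk ?_
    obtain ⟨v, rfl⟩ := X_dvd_iff.2 hu
    have : n < k := by simpa using hkn
    simp only
    rw [mul_pow, coeff_X_pow_mul', if_neg (by omega), smul_zero]

lemma coeff_trinomial_pow (n k : ℕ) :
    coeff n ((3 * X - 3 * X ^ 3 + X ^ 7 : PowerSeries ℚ) ^ k) =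
      ∑ j ∈ Finset.range (k + 1), ∑ i ∈ Finset.range (k - j + 1),
        if k + 2 * i + 6 * j = n then
          (k.choose j : ℚ) * ((k - j).choose i : ℚ) * ((-3) ^ i * 3 ^ (k - j - i)) else 0 := by
  have h : (3 * X - 3 * X ^ 3 + X ^ 7 : PowerSeries ℚ) =
      X ^ 7 + (C (-3) * X ^ 3 + C 3 * X) := by
    have : (C (3 : ℚ) : PowerSeries ℚ) = 3 := map_ofNat C 3
    rw [map_neg, this]; ring
  rw [h, add_pow, map_sum]
  refine Finset.sum_congr rfl fun j hj => ?_
  rw [add_pow, Finset.mul_sum, Finset.sum_mul, map_sum]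
  refine Finset.sum_congr rfl fun i hi => ?_
  have hj' := Finset.mem_range.1 hj
  have hi' := Finset.mem_range.1 hi
  have e : ((X : PowerSeries ℚ) ^ 7) ^ j * ((C (-3) * X ^ 3) ^ i * (C 3 * X) ^ (k - j - i) *
      (((k - j).choose i : ℕ) : PowerSeries ℚ)) * ((k.choose j : ℕ) : PowerSeries ℚ) =
      C ((k.choose j : ℚ) * ((k - j).choose i : ℚ) * ((-3) ^ i * 3 ^ (k - j - i))) *
        X ^ (7 * j + 3 * i + (k - j - i)) := by
    simp only [map_mul, map_pow, map_natCast]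
    ring
  rw [e, coeff_C_mul, coeff_X_pow, mul_ite, mul_one, mul_zero]
  exact if_congr (by omega) rfl rfl

/-- The degree condition forces `k = n - 2 i - 6 j`, so the sum over `k` disappears; the three
binomials telescope to the multinomial. -/
lemma sum_trinomial_eq (n : ℕ) :
    ∑ k ∈ Finset.range (n + 1), ((n + k).choose n : ℚ) *
      ∑ j ∈ Finset.range (k + 1), ∑ i ∈ Finset.range (k - j + 1),
        (if k + 2 * i + 6 * j = n then
          (k.choose j : ℚ) * ((k - j).choose i : ℚ) * ((-3) ^ i * 3 ^ (k - j - i)) else 0) =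
    ∑ j ∈ Finset.range (n / 7 + 1), ∑ i ∈ Finset.range ((n - 7 * j) / 3 + 1),
      (((2 * (n - i - 3 * j)).factorial : ℚ) /
        ((n.factorial : ℚ) * ((n - 3 * i - 7 * j).factorial : ℚ) *
          (i.factorial : ℚ) * (j.factorial : ℚ))) *
        (-1 : ℚ) ^ i * (3 : ℚ) ^ (n - 2 * i - 7 * j) := by
  simp only [Finset.mul_sum, mul_ite, mul_zero]
  rw [Finset.sum_sigma', Finset.sum_sigma', Finset.sum_sigma', ← Finset.sum_filter]
  refine Finset.sum_bij' (fun x _ => ⟨x.1.2, x.2⟩)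
    (fun y _ => ⟨⟨n - 2 * y.2 - 6 * y.1, y.1⟩, y.2⟩) ?_ ?_ ?_ ?_ ?_
  · rintro ⟨⟨k, j⟩, i⟩ h
    simp only [Finset.mem_filter, Finset.mem_sigma, Finset.mem_range] at h ⊢
    omega
  · rintro ⟨j, i⟩ h
    simp only [Finset.mem_filter, Finset.mem_sigma, Finset.mem_range] at h ⊢
    omega
  · rintro ⟨⟨k, j⟩, i⟩ h
    simp only [Finset.mem_filter, Finset.mem_sigma, Finset.mem_range] at h ⊢
    obtain rfl : k = n - 2 * i - 6 * j := by omega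
    rfl
  · rintro ⟨j, i⟩ h
    rfl
  · rintro ⟨⟨k, j⟩, i⟩ h
    simp only [Finset.mem_filter, Finset.mem_sigma, Finset.mem_range] at h ⊢
    -- `a` is the number of factors `3 X` chosen; using it removes all truncated subtractions.
    obtain ⟨a, rfl⟩ : ∃ a, k = j + (i + a) := ⟨k - j - i, by omega⟩
    have e1 : 2 * (n - i - 3 * j) = n + (j + (i + a)) := by omega
    have e2 : n - 3 * i - 7 * j = a := by omega
    have e3 : n - 2 * i - 7 * j = i + a := by omega
    have e4 : j + (i + a) - j = i + a := by omega
    have e5 : i + a - i = a := by omega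
    have f := fun m : ℕ => (Nat.cast_ne_zero (R := ℚ)).2 (Nat.factorial_ne_zero m)
    rw [e1, e2, e3, e4, e5, Nat.cast_add_choose, Nat.cast_add_choose, Nat.cast_add_choose,
      neg_pow (3 : ℚ), pow_add (3 : ℚ) i a]
    field_simp [f]

lemma constantCoeff_trinomial :
    constantCoeff (3 * X - 3 * X ^ 3 + X ^ 7 : PowerSeries ℚ) = 0 := by simp

lemma ncard_splitDecomps_three (m : ℕ) :
    ((m + 1 : ℕ) : ℚ) * ((splitDecomps (∅ : Finset (Fin 3)) m).ncard : ℚ) =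
      coeff m ((1 - (3 * X - 3 * X ^ 3 + X ^ 7) : PowerSeries ℚ)⁻¹ ^ (m + 1)) := by
  have hF : (X * splitSeries (∅ : Finset (Fin 3))) *
      Polynomial.aeval (X * splitSeries (∅ : Finset (Fin 3)))
        (1 - (3 * Polynomial.X - 3 * Polynomial.X ^ 3 + Polynomial.X ^ 7) : Polynomial ℚ) = X := by
    simp only [map_sub, map_add, map_mul, map_pow, map_one, Polynomial.aeval_X, map_ofNat]
    linear_combination X * splitSeries_three
  have h := lagrange_inversion (by simp [Polynomial.coeff_one]) (by simp) hF m
  rw [coeff_succ_X_mul, splitSeries, coeff_mk] at h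
  have h3 : ((3 : Polynomial ℚ) : PowerSeries ℚ) = 3 :=
    map_ofNat Polynomial.coeToPowerSeries.ringHom 3
  rw [h]
  simp [h3]

end Coefficients

/-! ### Steps versus boxes, and the final count -/

lemma decompositions_two_succ (d m : ℕ) :
    decompositions d 2 (m + 1) = splitDecomps (∅ : Finset (Fin d)) m := by
  ext S
  constructor
  · rintro ⟨k, hk, hS⟩
    obtain rfl : m = k := by omega
    exact ⟨hS, by simp⟩
  · rintro ⟨hS, -⟩
    exact ⟨m, by omega, hS⟩

lemma setOf_isDyadicPartition_encard_eq (d m : ℕ) :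
    {S : Set (Set (Fin d → ℝ)) | IsDyadicPartition d S ∧ S.encard = ((m + 1 : ℕ) : ℕ∞)} =
      decompositions d 2 (m + 1) := by
  ext S
  constructor
  · rintro ⟨⟨k, hk⟩, hS⟩
    have : k + 1 = m + 1 := by exact_mod_cast hk.encard_eq.symm.trans hS
    obtain rfl : k = m := by omega
    exact ⟨k, by omega, hk⟩
  · rintro ⟨k, hk, hS⟩
    obtain rfl : m = k := by omega
    exact ⟨⟨m, hS⟩, hS.encard_eq⟩

theorem corollary7 (n : ℕ) (hn : 1 ≤ n) :
    (decompositions 3 2 n).Finite ∧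
    {S : Set (Set (Fin 3 → ℝ)) | IsDyadicPartition 3 S ∧ S.encard = (n : ℕ∞)}.encard =
      (hyperCatalan 3 2 n : ℕ∞) ∧
    (hyperCatalan 3 2 n : ℚ) =
      1 / (n : ℚ) *
        ∑ j ∈ Finset.range ((n - 1) / 7 + 1),
          ∑ i ∈ Finset.range ((n - 1 - 7 * j) / 3 + 1),
            ((Nat.factorial (2 * (n - 1 - i - 3 * j)) : ℚ) /
                ((Nat.factorial (n - 1) : ℚ) * (Nat.factorial (n - 1 - 3 * i - 7 * j) : ℚ) *
                  (Nat.factorial i : ℚ) * (Nat.factorial j : ℚ))) *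
              (-1 : ℚ) ^ i * (3 : ℚ) ^ (n - 1 - 2 * i - 7 * j) := by
  obtain ⟨m, rfl⟩ : ∃ m, n = m + 1 := ⟨n - 1, by omega⟩
  have hfin : (decompositions 3 2 (m + 1)).Finite := by
    rw [decompositions_two_succ]
    exact splitDecomps_finite _ _
  refine ⟨hfin, ?_, ?_⟩
  · rw [setOf_isDyadicPartition_encard_eq, hyperCatalan, hfin.cast_ncard_eq]
  · have h := ncard_splitDecomps_three m
    rw [PowerSeries.coeff_inv_one_sub_pow constantCoeff_trinomial] at h
    simp only [coeff_trinomial_pow] at h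
    rw [sum_trinomial_eq] at h
    rw [hyperCatalan, decompositions_two_succ, Nat.add_sub_cancel, ← h, one_div,
      inv_mul_cancel_left₀ (Nat.cast_ne_zero.2 (Nat.succ_ne_zero m))]
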